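/- Proposition (Optimal plans cannot be Lipschitz). Let $d \ge 2$, let $K \subset \mathbb{R}^d$ be a compact set with nonempty interior, and let $\rho$ be the uniform probability measure on $K$ (density $1/\mathrm{vol}(K)$ on $K$ and $0$ elsewhere). Let $\mathcal{Y} \subset \mathbb{R}^d$ be compact with nonempty interior. For probability measures $\mu,\nu$ on a Euclidean space, write $\Pi(\mu,\nu)$ for the set of couplings of $\mu$ and $\nu$, and $$W_2(\mu,\nu) = \Big(\inf_{\pi\in\Pi(\mu,\nu)} \int \|x-y\|^2 \,\mathrm{d}\pi(x,y)\Big)^{1/2}.$$ For a probability measure $\mu$ on $\mathcal{Y}$, let $T_{\rho\to\mu}$ be the ($\rho$-a.e. unique) optimal transport map from $\rho$ to $\mu$ for the cost $\|x-y\|^2$, that is, $(T_{\rho\to\mu})_\#\rho=\mu$ and the induced plan $\gamma_{\rho\to\mu} := (\mathrm{id},T_{\rho\to\mu})_\#\rho$ minimises $\int\|x-y\|^2\,\mathrm{d}\gamma(x,y)$ over all $\gamma\in\Pi(\rho,\mu)$. Then there does not exist a finite constant $C$, which may depend on $\rho$ and $\mathcal{Y}$, such that $$W_2(\gamma_{\rho\to\mu_0},\gamma_{\rho\to\mu_1})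 \le C\, W_2(\mu_0,\mu_1) \qquad \text{for all probability measures } \mu_0,\mu_1 \text{ on } \mathcal{Y},$$ where $W_2$ on the left-hand side is taken with respect to the Euclidean distance $\big(\|x_0-x_1\|^2+\|y_0-y_1\|^2\big)^{1/2}$ on $\mathbb{R}^d\times\mathbb{R}^d$. -/

import Mathlib

open MeasureTheory ProbabilityTheory Set
open scoped ENNReal NNReal

noncomputable section

/-- `Π(μ, ν)`: the measures on the product with first marginal `μ` and second marginal `ν`. -/
def couplings {X Y : Type*} [MeasurableSpace X] [MeasurableSpace Y]
    (μ : Measure X) (ν : Measure Y) : Set (Measure (X × Y)) :=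
  {γ | γ.map Prod.fst = μ ∧ γ.map Prod.snd = ν}

/-- The transport cost `∫ dist(x, y) ^ p dγ(x, y)` of a plan `γ`. -/
def transportCost {X : Type*} [PseudoEMetricSpace X] [MeasurableSpace X]
    (p : ℝ) (γ : Measure (X × X)) : ℝ≥0∞ :=
  ∫⁻ z, edist z.1 z.2 ^ p ∂γ

/-- The `p`-Wasserstein distance
`W_p(μ, ν) = (inf_{γ ∈ Π(μ, ν)} ∫ dist(x, y) ^ p dγ(x, y)) ^ (1 / p)`. -/
def wassersteinDist {X : Type*} [PseudoEMetricSpace X] [MeasurableSpace X]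
    (p : ℝ) (μ ν : Measure X) : ℝ≥0∞ :=
  (⨅ γ ∈ couplings μ ν, transportCost p γ) ^ (1 / p)

/-- `γ ∈ Π(μ, ν)` is an optimal transport plan for the `p`-cost. -/
def IsOptimalPlan {X : Type*} [PseudoEMetricSpace X] [MeasurableSpace X]
    (p : ℝ) (μ ν : Measure X) (γ : Measure (X × X)) : Prop :=
  γ ∈ couplings μ ν ∧ ∀ γ' ∈ couplings μ ν, transportCost p γ ≤ transportCost p γ'

/-- The plan `(id, T)_# ρ` induced by a map `T`. -/
def inducedPlan {X : Type*} [MeasurableSpace X] (ρ : Measure X) (T : X → X) :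
    Measure (X × X) :=
  ρ.map (fun x => (x, T x))

/-- `T` is an optimal transport map from `ρ` to `μ` for the `p`-cost: it pushes `ρ` forward to `μ`
and the plan it induces is optimal among all plans. -/
def IsOptimalMap {X : Type*} [PseudoEMetricSpace X] [MeasurableSpace X]
    (p : ℝ) (ρ μ : Measure X) (T : X → X) : Prop :=
  Measurable T ∧ ρ.map T = μ ∧ IsOptimalPlan p ρ μ (inducedPlan ρ T)

/-- The `p`-Wasserstein distance between two plans, for the Euclidean distance
`(‖x₀ - x₁‖ ^ 2 + ‖y₀ - y₁‖ ^ 2) ^ (1 / 2)` on the product space. (Lean's bare product carries the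
sup distance, so the plans are first transported to the `ℓ²` product.) -/
def planWassersteinDist {X : Type*} [PseudoEMetricSpace X] [MeasurableSpace X]
    (p : ℝ) (γ₀ γ₁ : Measure (X × X)) : ℝ≥0∞ :=
  wassersteinDist (X := WithLp 2 (X × X)) p
    (γ₀.map (WithLp.toLp 2)) (γ₁.map (WithLp.toLp 2))

/-- The uniform probability measure on a set `K` of positive finite volume: it has density
`1 / vol(K)` on `K`, and `0` elsewhere. -/
def uniformMeasure {X : Type*} [MeasureSpace X] (K : Set X) : Measure X :=
  (volume K)⁻¹ • volume.restrict K

end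

/-! Fix two coordinate directions `i ≠ j` and a small `h`. Let `D` be diagonal with entry `l` in
direction `i` and `l * h ^ 2` in all others; `x ↦ o + D (x - c)` is the gradient of a convex
quadratic. Replacing that quadratic by an affine function on an ellipsoid, of width of order `h` in
direction `i` and of order one in the others, keeps it convex and collapses the image of the
ellipsoid to one point. By duality the flattened map is still optimal.

Let `T₀` and `T₁` flatten on two such ellipsoids `A`, `B` centred at `c ± p`, with `p` along `j`.
Exchanging `A` and `B` by translation preserves `ρ` and moves images only by `D (2p)`, of size `h ^
2`. Hence `W₂(μ₀, μ₁) ^ 2` is at most of order `h ^ 4 * ρ (A ∪ B)`. The plans see more: over a fixed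
fraction of `A`, the map `T₁` retains a variation of order `h` in direction `i` which `T₀` has
erased, so the graphs are at distance of order `h` there and the squared distance of the plans is at
least of order `h ^ 2 * ρ A`. As `ρ (A ∪ B) = 2 * ρ A`, the ratio of the distances blows up like `1
/ h`.

The two bounds are `iInf_transportCost_map_le` and `le_iInf_transportCost_inducedPlan`, optimality
is `isOptimalMap_flattenedMap`, and `volume_ballCap_le_of_lipschitz` combines them. -/

/-! ### Duality, rearrangement and Wasserstein bounds -/

section General

variable {E : Type*} [NormedAddCommGroup E] [MeasurableSpace E] [BorelSpace E]
  [SecondCountableTopology E]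

/-- A map is optimal as soon as its graph is in the contact set of a pair of admissible
Kantorovich potentials. -/
theorem isOptimalMap_of_potentials (ρ : Measure E) (T : E → E) (hT : Measurable T)
    (a b : E → ℝ) (ha : Integrable a ρ) (hb : Measurable b)
    (hcost : Integrable (fun x => ‖x - T x‖ ^ 2) ρ)
    (hle : ∀ x y, a x + b y ≤ ‖x - y‖ ^ 2) (heq : ∀ x, a x + b (T x) = ‖x - T x‖ ^ 2) :
    IsOptimalMap 2 ρ (ρ.map T) T := by
  have hpair : Measurable fun x => (x, T x) := measurable_id.prodMk hT
  have hmem : inducedPlan ρ T ∈ couplings ρ (ρ.map T) := by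
    constructor
    · rw [inducedPlan, Measure.map_map measurable_fst hpair]
      exact Measure.map_id
    · rw [inducedPlan, Measure.map_map measurable_snd hpair]
      rfl
  refine ⟨hT, rfl, hmem, ?_⟩
  have hbT : Integrable (fun x => b (T x)) ρ := by
    refine (hcost.sub ha).congr (.of_forall fun x => ?_)
    simp only [Pi.sub_apply]
    linarith [heq x]
  have hbμ : Integrable b (ρ.map T) :=
    (integrable_map_measure hb.aestronglyMeasurable hT.aemeasurable).2 hbT
  have hsq : ∀ z : E × E, edist z.1 z.2 ^ (2 : ℝ) = ENNReal.ofReal (‖z.1 - z.2‖ ^ 2) := by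
    intro z
    rw [edist_dist, dist_eq_norm, ENNReal.rpow_ofNat, ENNReal.ofReal_pow (norm_nonneg _)]
  intro γ hγ
  have h1 : Integrable (fun z : E × E => a z.1) γ := by
    have := ha
    rw [← hγ.1] at this
    exact this.comp_measurable measurable_fst
  have h2 : Integrable (fun z : E × E => b z.2) γ := by
    have := hbμ
    rw [← hγ.2] at this
    exact this.comp_measurable measurable_snd
  have i1 : ∫ z, a z.1 ∂γ = ∫ x, a x ∂ρ := by
    have := ha.1
    rw [← hγ.1] at this
    rw [← integral_map measurable_fst.aemeasurable this, hγ.1]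
  have i2 : ∫ z, b z.2 ∂γ = ∫ x, b (T x) ∂ρ := by
    have h := integral_map (μ := γ) measurable_snd.aemeasurable
      (f := b) hb.aestronglyMeasurable
    rw [← h, hγ.2, integral_map hT.aemeasurable hb.aestronglyMeasurable]
  calc transportCost 2 (inducedPlan ρ T)
      = ∫⁻ x, ENNReal.ofReal (‖x - T x‖ ^ 2) ∂ρ := by
        simp only [transportCost, hsq, inducedPlan]
        rw [lintegral_map (by fun_prop) hpair]
    _ = ENNReal.ofReal (∫ x, ‖x - T x‖ ^ 2 ∂ρ) :=
        (ofReal_integral_eq_lintegral_ofReal hcost (.of_forall fun x => by positivity)).symm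
    _ = ENNReal.ofReal (∫ z, (a z.1 + b z.2) ∂γ) := by
        rw [integral_add h1 h2, i1, i2, ← integral_add ha hbT]
        simp only [heq]
    _ ≤ ∫⁻ z, ENNReal.ofReal (a z.1 + b z.2) ∂γ := by
        have h12 : Integrable (fun z : E × E => a z.1 + b z.2) γ := h1.add h2
        rw [integral_eq_lintegral_pos_part_sub_lintegral_neg_part h12]
        refine (ENNReal.ofReal_le_ofReal (sub_le_self _ ENNReal.toReal_nonneg)).trans ?_
        exact ENNReal.ofReal_toReal_le
    _ ≤ transportCost 2 γ := by
        simp only [transportCost, hsq]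
        exact lintegral_mono fun z => ENNReal.ofReal_le_ofReal (hle _ _)

/-- Upper bound for the Wasserstein distance of two images of `ρ`, after rearranging `ρ` by a
measure preserving map. -/
theorem iInf_transportCost_map_le {X : Type*} [MeasurableSpace X] (ρ : Measure X) (T₀ T₁ : X → E)
    (hT₀ : Measurable T₀) (hT₁ : Measurable T₁) (σ : X → X) (hσ : MeasurePreserving σ ρ ρ)
    (S : Set X) (hS : MeasurableSet S) (δ : ℝ≥0∞)
    (hon : ∀ x ∈ S, edist (T₀ x) (T₁ (σ x)) ≤ δ) (hoff : ∀ x ∉ S, T₀ x = T₁ (σ x)) :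
    ⨅ γ ∈ couplings (ρ.map T₀) (ρ.map T₁), transportCost 2 γ ≤ δ ^ 2 * ρ S := by
  have hσT := hT₁.comp hσ.measurable
  have hpair : Measurable fun x => (T₀ x, T₁ (σ x)) := hT₀.prodMk hσT
  have hmem : ρ.map (fun x => (T₀ x, T₁ (σ x))) ∈ couplings (ρ.map T₀) (ρ.map T₁) := by
    constructor
    · rw [Measure.map_map measurable_fst hpair]
      rfl
    · rw [Measure.map_map measurable_snd hpair]
      conv_rhs => rw [← hσ.map_eq, Measure.map_map hT₁ hσ.measurable]
      rfl
  refine (iInf₂_le _ hmem).trans ?_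
  rw [transportCost, lintegral_map (by fun_prop) hpair, ← lintegral_indicator_const hS]
  refine lintegral_mono fun x => ?_
  by_cases hx : x ∈ S
  · simp only [indicator_of_mem hx, ENNReal.rpow_ofNat]
    exact pow_le_pow_left' (hon x hx) 2
  · simp [hoff x hx]

/-- Lower bound for the Wasserstein distance of two induced plans: points of the first graph over
`S` are at distance at least `δ` from the second graph. -/
theorem le_iInf_transportCost_inducedPlan (ρ : Measure E) (T₀ T₁ : E → E)
    (hT₀ : Measurable T₀) (hT₁ : Measurable T₁) (S : Set E) (hS : MeasurableSet S) (δ : ℝ≥0∞)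
    (hdist : ∀ x ∈ S, ∀ x',
      δ ≤ edist (WithLp.toLp 2 (x, T₀ x)) (WithLp.toLp 2 (x', T₁ x'))) :
    δ ^ 2 * ρ S ≤ ⨅ γ ∈ couplings ((inducedPlan ρ T₀).map (WithLp.toLp 2))
      ((inducedPlan ρ T₁).map (WithLp.toLp 2)), transportCost 2 γ := by
  have hm : ∀ T : E → E, Measurable T → Measurable fun x => WithLp.toLp 2 (x, T x) := by
    intro T hT
    exact (WithLp.measurable_toLp 2 (E × E)).comp (measurable_id.prodMk hT)
  have hmap : ∀ T : E → E, Measurable T →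
      (inducedPlan ρ T).map (WithLp.toLp 2) = ρ.map fun x => WithLp.toLp 2 (x, T x) := by
    intro T hT
    have hpair : Measurable fun x => (x, T x) := measurable_id.prodMk hT
    rw [inducedPlan, Measure.map_map (WithLp.measurable_toLp 2 (E × E)) hpair]
    rfl
  -- Each marginal is concentrated on a graph, so a coupling charges only pairs of graph points,
  -- where `hdist` applies.
  have hgraph : ∀ T : E → E, Measurable T →
      ∀ᵐ v ∂(ρ.map fun x => WithLp.toLp 2 (x, T x)), v = WithLp.toLp 2 (v.fst, T v.fst) := by
    intro T hT
    have hfst : Measurable fun v : WithLp 2 (E × E) => v.fst :=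
      measurable_fst.comp (WithLp.measurable_ofLp 2 (E × E))
    rw [ae_map_iff (hm T hT).aemeasurable]
    · exact .of_forall fun x => rfl
    · have hset : {v : WithLp 2 (E × E) | v = WithLp.toLp 2 (v.fst, T v.fst)}
          = {v | v.snd = T v.fst} := by
        ext v
        constructor
        · intro hv
          exact congrArg (fun u : WithLp 2 (E × E) => u.snd) hv
        · intro hv
          change v = WithLp.toLp 2 (v.fst, T v.fst)
          rw [← show v.snd = T v.fst from hv]
          rfl
      rw [hset]
      exact measurableSet_eq_fun (measurable_snd.comp (WithLp.measurable_ofLp 2 (E × E)))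
        (hT.comp hfst)
  rw [hmap T₀ hT₀, hmap T₁ hT₁]
  refine le_iInf₂ fun γ hγ => ?_
  have hfst : Measurable fun v : WithLp 2 (E × E) => v.fst :=
    measurable_fst.comp (WithLp.measurable_ofLp 2 (E × E))
  have g₀ : ∀ᵐ v ∂γ, v.1 = WithLp.toLp 2 (v.1.fst, T₀ v.1.fst) := by
    have := hgraph T₀ hT₀
    rw [← hγ.1] at this
    exact ae_of_ae_map measurable_fst.aemeasurable this
  have g₁ : ∀ᵐ v ∂γ, v.2 = WithLp.toLp 2 (v.2.fst, T₁ v.2.fst) := by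
    have := hgraph T₁ hT₁
    rw [← hγ.2] at this
    exact ae_of_ae_map measurable_snd.aemeasurable this
  have hSγ : ρ S = γ ((fun v => v.1.fst) ⁻¹' S) := by
    have h : (γ.map Prod.fst) ((fun v : WithLp 2 (E × E) => v.fst) ⁻¹' S) = ρ S := by
      rw [hγ.1, Measure.map_apply (hm T₀ hT₀) (hfst hS)]
      rfl
    rw [← h, Measure.map_apply measurable_fst (hfst hS)]
    rfl
  have hSm : MeasurableSet ((fun v : WithLp 2 (E × E) × WithLp 2 (E × E) => v.1.fst) ⁻¹' S) :=
    (hfst.comp measurable_fst) hS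
  rw [hSγ, ← lintegral_indicator_const hSm, transportCost]
  refine lintegral_mono_ae ?_
  filter_upwards [g₀, g₁] with v h₀ h₁
  by_cases hv : v.1.fst ∈ S
  · rw [indicator_of_mem (by exact hv), h₀, h₁, ENNReal.rpow_ofNat]
    exact pow_le_pow_left' (hdist _ hv _) 2
  · rw [indicator_of_notMem (by exact hv)]
    exact zero_le

end General

/-- Exchange of a set `A` with its translate `B = A + v`. -/
theorem measurePreserving_translationSwap {G : Type*} [AddCommGroup G] [MeasurableSpace G]
    [MeasurableAdd₂ G] [MeasurableSub G] (m : Measure G) [m.IsAddLeftInvariant] (A B : Set G) (v : G)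
    (hA : MeasurableSet A) (hB : MeasurableSet B) (hAB : Disjoint A B)
    (hv : ∀ x, x ∈ A ↔ x + v ∈ B) (σ : G → G) (hσA : ∀ x ∈ A, σ x = x + v)
    (hσB : ∀ x ∈ B, σ x = x - v) (hσ : ∀ x, x ∉ A → x ∉ B → σ x = x) :
    MeasurePreserving σ m m := by
  -- The preimage is a disjoint union of a translate of `B ∩ s`, a translate of `A ∩ s` and the
  -- untouched rest, so invariance applies piecewise.
  have hpre : ∀ s, σ ⁻¹' s = ((· + v) ⁻¹' (B ∩ s) ∪ (· - v) ⁻¹' (A ∩ s)) ∪ (s \ (A ∪ B)) := by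
    intro s
    ext x
    have hvB : x ∈ B ↔ x - v ∈ A := by rw [hv, sub_add_cancel]
    simp only [mem_preimage, mem_union, mem_inter_iff, mem_sdiff, ← hv, ← hvB]
    by_cases hxA : x ∈ A
    · have : x ∉ B := disjoint_left.1 hAB hxA
      simp [hσA x hxA, hxA, this]
    · by_cases hxB : x ∈ B
      · simp [hσB x hxB, hxA, hxB]
      · simp [hσ x hxA hxB, hxA, hxB]
  have hmeas : ∀ s, MeasurableSet s → MeasurableSet (σ ⁻¹' s) := by
    intro s hs
    rw [hpre]
    exact (((measurable_add_const v) (hB.inter hs)).union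
      ((measurable_sub_const v) (hA.inter hs))).union (hs.diff (hA.union hB))
  refine ⟨fun s hs => hmeas s hs, Measure.ext fun s hs => ?_⟩
  rw [Measure.map_apply (fun s hs => hmeas s hs) hs, hpre]
  have hsub : (· - v) ⁻¹' (A ∩ s) = (· + -v) ⁻¹' (A ∩ s) := by simp only [sub_eq_add_neg]
  have d1 : Disjoint ((· + v) ⁻¹' (B ∩ s) ∪ (· - v) ⁻¹' (A ∩ s)) (s \ (A ∪ B)) := by
    rw [disjoint_left]
    rintro x (hx | hx) ⟨-, hn⟩
    · exact hn (.inl ((hv x).2 hx.1))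
    · exact hn (.inr (by have := (hv _).1 hx.1; rwa [sub_add_cancel] at this))
  have d2 : Disjoint ((· + v) ⁻¹' (B ∩ s)) ((· - v) ⁻¹' (A ∩ s)) := by
    rw [disjoint_left]
    intro x hx hx'
    have := (hv _).1 hx'.1
    rw [sub_add_cancel] at this
    exact disjoint_left.1 hAB ((hv x).2 hx.1) this
  rw [measure_union d1 (hs.diff (hA.union hB)), measure_union d2
    ((measurable_sub_const v) (hA.inter hs)), hsub, measure_preimage_add_right,
    measure_preimage_add_right, ← measure_union _ (hA.inter hs),
    ← union_inter_distrib_right, union_comm B A, inter_comm, measure_inter_add_sdiff s (hA.union hB)]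
  exact hAB.symm.mono inter_subset_left inter_subset_left

/-! ### Flattened diagonal maps and their optimality -/

noncomputable section

section Flattened

variable {ι : Type*}

/-- Multiplication of each coordinate by a weight. -/
def diagScale (w : ι → ℝ) : EuclideanSpace ℝ ι →ₗ[ℝ] EuclideanSpace ℝ ι where
  toFun x := WithLp.toLp 2 fun k => w k * x k
  map_add' x y := by ext k; simp [mul_add]
  map_smul' r x := by ext k; simp [mul_left_comm]

theorem diagScale_apply (w : ι → ℝ) (x : EuclideanSpace ℝ ι) (k : ι) :
    diagScale w x k = w k * x k := rfl

theorem diagScale_injective {w : ι → ℝ} (hw : ∀ k, w k ≠ 0) : Function.Injective (diagScale w) := by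
  intro x y hxy
  ext k
  have := congrArg (fun v : EuclideanSpace ℝ ι => v k) hxy
  simpa [diagScale_apply, hw k] using this

variable [Fintype ι]

theorem continuous_diagScale (w : ι → ℝ) : Continuous (diagScale w) :=
  (diagScale w).continuous_of_finiteDimensional

theorem det_diagScale_ne_zero {w : ι → ℝ} (hw : ∀ k, w k ≠ 0) :
    LinearMap.det (diagScale w) ≠ 0 :=
  (LinearEquiv.isUnit_det' (LinearEquiv.ofInjectiveEndo (diagScale w)
    (diagScale_injective hw))).ne_zero

/-- The quadratic form of a diagonal matrix. -/
def weightedSq (w : ι → ℝ) (x : EuclideanSpace ℝ ι) : ℝ := ∑ k, w k * x k ^ 2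

theorem weightedSq_zero (w : ι → ℝ) : weightedSq w 0 = 0 := by simp [weightedSq]

theorem continuous_weightedSq (w : ι → ℝ) : Continuous (weightedSq w) := by
  unfold weightedSq
  fun_prop

/-- Fenchel–Young for half the quadratic form and its conjugate; the deficit is a square in each
coordinate. -/
theorem sum_mul_le_weightedSq {w : ι → ℝ} (hw : ∀ k, 0 < w k) (x y : EuclideanSpace ℝ ι) :
    ∑ k, x k * y k ≤ (weightedSq w x + weightedSq (fun k => (w k)⁻¹) y) / 2 := by
  rw [weightedSq, weightedSq, ← Finset.sum_add_distrib, Finset.sum_div]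
  refine Finset.sum_le_sum fun k _ => ?_
  have h := hw k
  have : (w k * x k ^ 2 + (w k)⁻¹ * y k ^ 2) / 2 - x k * y k
      = (w k)⁻¹ * (w k * x k - y k) ^ 2 / 2 := by field_simp; ring
  have : 0 ≤ (w k)⁻¹ * (w k * x k - y k) ^ 2 / 2 := by positivity
  linarith

/-- The exact Fenchel–Young deficit at a gradient; it vanishes for `x = p`. -/
theorem sum_mul_diagScale {w : ι → ℝ} (hw : ∀ k, 0 < w k) (x p : EuclideanSpace ℝ ι) :
    ∑ k, x k * diagScale w p k = (weightedSq w x + weightedSq (fun k => (w k)⁻¹) (diagScale w p)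
      - weightedSq w (x - p)) / 2 := by
  simp only [weightedSq, ← Finset.sum_add_distrib, ← Finset.sum_sub_distrib, Finset.sum_div]
  refine Finset.sum_congr rfl fun k _ => ?_
  have h := (hw k).ne'
  simp only [diagScale_apply, PiLp.sub_apply]
  field_simp
  ring

/-- Up to terms in `x` or `y` alone, which the potentials absorb, the cost is a pairing based at `c`
and `o`. -/
theorem norm_sub_sq_eq_shift (c o x y : EuclideanSpace ℝ ι) :
    ‖x - y‖ ^ 2 = ‖x‖ ^ 2 + ‖y‖ ^ 2
      - 2 * (∑ k, (x - c) k * (y - o) k + ∑ k, c k * y k + ∑ k, x k * o k - ∑ k, c k * o k) := by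
  simp only [EuclideanSpace.real_norm_sq_eq, ← Finset.sum_add_distrib, ← Finset.sum_sub_distrib,
    Finset.mul_sum, PiLp.sub_apply]
  refine Finset.sum_congr rfl fun k _ => ?_
  ring

open Classical in
/-- The affine map `x ↦ o + w (x - c)`, made constant on the ellipsoid
`weightedSq w (x - P) < t` with centre `P`. -/
def flattenedMap (w : ι → ℝ) (c o P : EuclideanSpace ℝ ι) (t : ℝ) (x : EuclideanSpace ℝ ι) :
    EuclideanSpace ℝ ι :=
  if weightedSq w (x - P) < t then o + diagScale w (P - c) else o + diagScale w (x - c)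

theorem measurableSet_ellipsoid (w : ι → ℝ) (P : EuclideanSpace ℝ ι) (t : ℝ) :
    MeasurableSet {x | weightedSq w (x - P) < t} :=
  measurableSet_lt ((continuous_weightedSq w).comp (continuous_sub_right P)).measurable
    measurable_const

theorem measurable_flattenedMap (w : ι → ℝ) (c o P : EuclideanSpace ℝ ι) (t : ℝ) :
    Measurable (flattenedMap w c o P t) :=
  Measurable.ite (measurableSet_ellipsoid w P t) measurable_const
    (measurable_const.add ((continuous_diagScale w).comp (continuous_sub_right c)).measurable)

/-- The map follows the gradient of a maximum of a convex quadratic and an affine function, with the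
value at `P` chosen on the flat piece. -/
theorem isOptimalMap_flattenedMap {w : ι → ℝ} (hw : ∀ k, 0 < w k) (c o P : EuclideanSpace ℝ ι)
    {t : ℝ} (ht : 0 < t) (ρ : Measure (EuclideanSpace ℝ ι))
    (hint : ∀ f : EuclideanSpace ℝ ι → ℝ, Continuous f → Integrable f ρ)
    (hcost : Integrable (fun x => ‖x - flattenedMap w c o P t x‖ ^ 2) ρ) :
    IsOptimalMap 2 ρ (ρ.map (flattenedMap w c o P t)) (flattenedMap w c o P t) := by
  classical
  -- `weightedSq w (x - c) - weightedSq w (x - P)` is affine in `x`, so `φ` is half the maximum of a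
  -- quadratic and an affine function. `ψ` is the conjugate of the quadratic, lowered by `t / 2` at
  -- the collapsed value only.
  set φ : EuclideanSpace ℝ ι → ℝ := fun x =>
    (weightedSq w (x - c) + max 0 (t - weightedSq w (x - P))) / 2 with hφ
  set ψ : EuclideanSpace ℝ ι → ℝ := fun y => (weightedSq (fun k => (w k)⁻¹) (y - o)
    - if y = o + diagScale w (P - c) then t else 0) / 2 with hψ
  have hle : ∀ x y, ∑ k, (x - c) k * (y - o) k ≤ φ x + ψ y := by
    intro x y
    by_cases hy : y = o + diagScale w (P - c)
    · have h := sum_mul_diagScale hw (x - c) (P - c)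
      rw [sub_sub_sub_cancel_right] at h
      have hm := le_max_right 0 (t - weightedSq w (x - P))
      simp only [hφ, hψ, hy, if_true, add_sub_cancel_left]
      linarith
    · have h := sum_mul_le_weightedSq hw (x - c) (y - o)
      have hm := le_max_left 0 (t - weightedSq w (x - P))
      simp only [hφ, hψ, hy, if_false]
      linarith
  have heq : ∀ x, ∑ k, (x - c) k * (flattenedMap w c o P t x - o) k
      = φ x + ψ (flattenedMap w c o P t x) := by
    intro x
    by_cases hx : weightedSq w (x - P) < t
    · have h := sum_mul_diagScale hw (x - c) (P - c)
      rw [sub_sub_sub_cancel_right] at h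
      have hm := max_eq_right (sub_pos.2 hx).le
      simp only [flattenedMap, hx, hφ, hψ, if_true, add_sub_cancel_left, hm]
      linarith
    · have h := sum_mul_diagScale hw (x - c) (x - c)
      rw [sub_self, weightedSq_zero] at h
      have hm := max_eq_left (sub_nonpos.2 (not_lt.1 hx))
      -- The lowered value of `ψ` is never met off the ellipsoid: the map is injective there and `0
      -- < t` puts `P` inside.
      have hne : diagScale w (x - c) ≠ diagScale w (P - c) := by
        intro he
        have := sub_left_injective (diagScale_injective (fun k => (hw k).ne') he)
        rw [this, sub_self, weightedSq_zero] at hx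
        exact hx ht
      simp only [flattenedMap, hx, hφ, hψ, if_false, add_sub_cancel_left, hm, add_right_inj, hne]
      linarith
  have hφc : Continuous φ := by
    have h1 := (continuous_weightedSq w).comp (continuous_sub_right c)
    have h2 := (continuous_weightedSq w).comp (continuous_sub_right P)
    exact (h1.add (continuous_const.max (continuous_const.sub h2))).div_const 2
  have hψm : Measurable ψ := by
    have h1 := ((continuous_weightedSq fun k => (w k)⁻¹).comp (continuous_sub_right o)).measurable
    exact (h1.sub (Measurable.ite (measurableSet_singleton _) measurable_const
      measurable_const)).div_const 2
  refine isOptimalMap_of_potentials ρ _ (measurable_flattenedMap w c o P t)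
    (fun x => ‖x‖ ^ 2 - 2 * (φ x + ∑ k, x k * o k - ∑ k, c k * o k))
    (fun y => ‖y‖ ^ 2 - 2 * (ψ y + ∑ k, c k * y k)) (hint _ (by fun_prop)) (by fun_prop) hcost
    (fun x y => ?_) (fun x => ?_)
  · rw [norm_sub_sq_eq_shift c o]
    linarith [hle x y]
  · rw [norm_sub_sq_eq_shift c o]
    linarith [heq x]

theorem norm_diagScale_le {w : ι → ℝ} {l : ℝ} (hl : 0 ≤ l) (hw : ∀ k, |w k| ≤ l)
    (x : EuclideanSpace ℝ ι) : ‖diagScale w x‖ ≤ l * ‖x‖ := by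
  refine le_of_sq_le_sq ?_ (by positivity)
  rw [mul_pow, EuclideanSpace.real_norm_sq_eq, EuclideanSpace.real_norm_sq_eq, Finset.mul_sum]
  refine Finset.sum_le_sum fun k _ => ?_
  rw [diagScale_apply, mul_pow]
  exact mul_le_mul_of_nonneg_right (sq_le_sq' (abs_le.1 (hw k)).1 (abs_le.1 (hw k)).2)
    (sq_nonneg _)

theorem flattenedMap_mem_closedBall {w : ι → ℝ} {l M : ℝ} (hl : 0 ≤ l) (hw : ∀ k, |w k| ≤ l)
    (c o P : EuclideanSpace ℝ ι) (t : ℝ) (hP : ‖P - c‖ ≤ M) (x : EuclideanSpace ℝ ι)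
    (hx : ‖x - c‖ ≤ M) : flattenedMap w c o P t x ∈ Metric.closedBall o (l * M) := by
  rw [mem_closedBall_iff_norm]
  unfold flattenedMap
  split_ifs
  · rw [add_sub_cancel_left]
    exact (norm_diagScale_le hl hw _).trans (mul_le_mul_of_nonneg_left hP hl)
  · rw [add_sub_cancel_left]
    exact (norm_diagScale_le hl hw _).trans (mul_le_mul_of_nonneg_left hx hl)

/-- The volume of a set described in rescaled coordinates is a multiple of the volume of the
describing set. -/
theorem exists_volume_preimage_diagScale {g : ι → ℝ} (hg : ∀ k, g k ≠ 0) :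
    ∃ κ : ℝ≥0∞, κ ≠ 0 ∧ κ ≠ ∞ ∧ ∀ (P : EuclideanSpace ℝ ι) (U : Set (EuclideanSpace ℝ ι)),
      volume {x | diagScale g (x - P) ∈ U} = κ * volume U := by
  have hdet := det_diagScale_ne_zero hg
  refine ⟨ENNReal.ofReal |(LinearMap.det (diagScale g))⁻¹|, ?_, ENNReal.ofReal_ne_top, ?_⟩
  · rw [Ne, ENNReal.ofReal_eq_zero, not_le]
    positivity
  · intro P U
    rw [← Measure.addHaar_preimage_linearMap volume hdet U,
      ← measure_preimage_add_right volume (-P) (diagScale g ⁻¹' U)]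
    simp only [sub_eq_add_neg]
    rfl

end Flattened

theorem isProbabilityMeasure_uniformMeasure {X : Type*} [MeasureSpace X] {K : Set X}
    (h0 : volume K ≠ 0) (h1 : volume K ≠ ∞) : IsProbabilityMeasure (uniformMeasure K) := by
  constructor
  simp [uniformMeasure, ENNReal.inv_mul_cancel h0 h1]

theorem integrable_uniformMeasure {X : Type*} [MeasureSpace X] {K : Set X}
    (h0 : volume K ≠ 0) {f : X → ℝ} (hf : IntegrableOn f K) :
    Integrable f (uniformMeasure K) :=
  Integrable.smul_measure hf (ENNReal.inv_ne_top.2 h0)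

end

/-! ### The estimate at thickness `h` -/

noncomputable section

/-- The part of the ball of radius `s` where the `i`-th coordinate exceeds `s / 2`. -/
def ballCap {ι : Type*} [Fintype ι] (i : ι) (s : ℝ) : Set (EuclideanSpace ℝ ι) :=
  Metric.ball 0 s ∩ {u | s / 2 < u i}

theorem isOpen_ballCap {ι : Type*} [Fintype ι] (i : ι) (s : ℝ) : IsOpen (ballCap i s) :=
  Metric.isOpen_ball.inter (isOpen_lt continuous_const (by fun_prop))

theorem ballCap_nonempty {ι : Type*} [Fintype ι] (i : ι) {s : ℝ} (hs : 0 < s) :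
    (ballCap i s).Nonempty := by
  classical
  refine ⟨EuclideanSpace.single i (3 * s / 4), ?_, ?_⟩
  · rw [mem_ball_zero_iff, PiLp.norm_single, Real.norm_of_nonneg (by positivity)]
    linarith
  · simp only [mem_ofPred_eq, PiLp.single_apply, if_true]
    linarith

/-- The right side is the squared distance from `(a, 0)` to a point of the line of slope `l`, hence
at least `l ^ 2 * a ^ 2 / (1 + l ^ 2)`; the constant used is smaller and free of roots. -/
theorem sq_mul_le_sub_sq_add {l a b : ℝ} (hl : 0 < l) :
    (l / (1 + l) * a) ^ 2 ≤ (a - b) ^ 2 + (l * b) ^ 2 := by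
  have h : (l / (1 + l) * a) ^ 2 * (1 + l) ^ 2 ≤ ((a - b) ^ 2 + (l * b) ^ 2) * (1 + l) ^ 2 := by
    have h1 : (l / (1 + l) * a) ^ 2 * (1 + l) ^ 2 = l ^ 2 * a ^ 2 := by field_simp
    have h2 : (1 + l ^ 2) * ((a - b) ^ 2 + (l * b) ^ 2) - l ^ 2 * a ^ 2
        = ((1 + l ^ 2) * b - a) ^ 2 := by ring
    have h3 : 0 ≤ l * ((a - b) ^ 2 + (l * b) ^ 2) := by positivity
    nlinarith [sq_nonneg ((1 + l ^ 2) * b - a)]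
  exact le_of_mul_le_mul_right h (by positivity)

theorem sq_apply_le_norm_sq {ι : Type*} [Fintype ι] (x : EuclideanSpace ℝ ι) (k : ι) :
    x k ^ 2 ≤ ‖x‖ ^ 2 := by
  rw [EuclideanSpace.real_norm_sq_eq]
  exact Finset.single_le_sum (f := fun k => x k ^ 2) (fun _ _ => sq_nonneg _) (Finset.mem_univ k)

/-- A Lipschitz bound for optimal plans, tested on two flattened maps whose ellipsoids have
thickness `h` and symmetric centres. -/
theorem volume_ballCap_le_of_lipschitz {ι : Type*} [Fintype ι] {i j : ι} (hij : i ≠ j)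
    {K Y : Set (EuclideanSpace ℝ ι)} {c o : EuclideanSpace ℝ ι} {R M l : ℝ} {C : ℝ≥0}
    (hK : IsCompact K) (hRK : Metric.ball c R ⊆ K) (hKM : K ⊆ Metric.closedBall c M)
    (hY : Metric.closedBall o (l * M) ⊆ Y) (hR : 0 < R) (hl : 0 < l)
    (hC : ∀ μ₀ μ₁ : Measure (EuclideanSpace ℝ ι),
      IsProbabilityMeasure μ₀ → IsProbabilityMeasure μ₁ → μ₀ Yᶜ = 0 → μ₁ Yᶜ = 0 →
      ∀ T₀ T₁ : EuclideanSpace ℝ ι → EuclideanSpace ℝ ι,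
        IsOptimalMap 2 (uniformMeasure K) μ₀ T₀ → IsOptimalMap 2 (uniformMeasure K) μ₁ T₁ →
        planWassersteinDist 2 (inducedPlan (uniformMeasure K) T₀)
            (inducedPlan (uniformMeasure K) T₁)
          ≤ (C : ℝ≥0∞) * wassersteinDist 2 μ₀ μ₁)
    {h : ℝ} (h0 : 0 < h) (h1 : h ≤ 1) :
    ENNReal.ofReal (l / (1 + l) * (h * (R / 8))) ^ 2 * volume (ballCap i (R / 4))
      ≤ C ^ 2 * (ENNReal.ofReal (l * h ^ 2 * R) ^ 2
        * (2 * volume (Metric.ball (0 : EuclideanSpace ℝ ι) (R / 4)))) := by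
  classical
  set ρ := uniformMeasure K with hρ
  have hK0 : volume K ≠ 0 := ((Metric.measure_ball_pos volume c hR).trans_le (measure_mono hRK)).ne'
  have hKtop : volume K ≠ ∞ := hK.measure_lt_top.ne
  have : IsProbabilityMeasure ρ := isProbabilityMeasure_uniformMeasure hK0 hKtop
  -- `g` rescales the ellipsoid `weightedSq w < t` to the ball of radius `R / 4`. As `1 ≤ g k`, the
  -- ellipsoid itself lies in that ball, so the centres `c ± p` with `‖p‖ = R / 2` give disjoint
  -- ellipsoids inside `ball c R`.
  set w : ι → ℝ := fun k => if k = i then l else l * h ^ 2 with hwdef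
  set g : ι → ℝ := fun k => if k = i then h⁻¹ else 1 with hgdef
  set t : ℝ := l * h ^ 2 * (R / 4) ^ 2 with htdef
  have ht : 0 < t := by positivity
  have hh : h ^ 2 ≤ 1 := pow_le_one₀ h0.le h1
  have hw : ∀ k, 0 < w k := by
    intro k
    simp only [hwdef]
    split_ifs <;> positivity
  have hwl : ∀ k, |w k| ≤ l := by
    intro k
    rw [abs_of_pos (hw k)]
    simp only [hwdef]
    split_ifs
    · exact le_rfl
    · nlinarith
  have hg1 : ∀ k, 1 ≤ g k := by
    intro k
    simp only [hgdef]
    split_ifs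
    · exact (one_le_inv₀ h0).2 h1
    · exact le_rfl
  have hg : ∀ k, g k ≠ 0 := fun k => (zero_lt_one.trans_le (hg1 k)).ne'
  have hwg : ∀ x, weightedSq w x = l * h ^ 2 * ‖diagScale g x‖ ^ 2 := by
    intro x
    rw [EuclideanSpace.real_norm_sq_eq, weightedSq, Finset.mul_sum]
    refine Finset.sum_congr rfl fun k _ => ?_
    simp only [diagScale_apply, hwdef, hgdef]
    split_ifs
    · field_simp
    · ring
  have hnorm : ∀ x, ‖x‖ ≤ ‖diagScale g x‖ := by
    intro x
    refine le_of_sq_le_sq ?_ (norm_nonneg _)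
    rw [EuclideanSpace.real_norm_sq_eq, EuclideanSpace.real_norm_sq_eq]
    refine Finset.sum_le_sum fun k _ => ?_
    rw [diagScale_apply, mul_pow]
    exact le_mul_of_one_le_left (sq_nonneg _) (one_le_pow₀ (hg1 k))
  have hell : ∀ P x, weightedSq w (x - P) < t ↔
      diagScale g (x - P) ∈ Metric.ball (0 : EuclideanSpace ℝ ι) (R / 4) := by
    intro P x
    rw [hwg, mem_ball_zero_iff, htdef, mul_lt_mul_iff_right₀ (by positivity),
      sq_lt_sq₀ (norm_nonneg _) (by positivity)]
  have hclose : ∀ P x, weightedSq w (x - P) < t → ‖x - P‖ < R / 4 := fun P x hx =>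
    (hnorm _).trans_lt (mem_ball_zero_iff.1 ((hell P x).1 hx))
  -- the two centres
  set p : EuclideanSpace ℝ ι := EuclideanSpace.single j (R / 2) with hp
  have hpn : ‖p‖ = R / 2 := by
    rw [hp, PiLp.norm_single, Real.norm_of_nonneg (by positivity)]
  have hpi : p i = 0 := by simp [hp, hij]
  have hpj : p j = R / 2 := by simp [hp]
  set A : Set (EuclideanSpace ℝ ι) := {x | weightedSq w (x - (c + p)) < t} with hA
  set B : Set (EuclideanSpace ℝ ι) := {x | weightedSq w (x - (c - p)) < t} with hB
  have hAm : MeasurableSet A := measurableSet_ellipsoid _ _ _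
  have hBm : MeasurableSet B := measurableSet_ellipsoid _ _ _
  have hAj : ∀ x ∈ A, R / 4 < (x - c) j := by
    intro x hx
    have h2 := sq_apply_le_norm_sq (x - (c + p)) j
    have h4 := (abs_le.1 (abs_le_of_sq_le_sq h2 (norm_nonneg _))).1
    have h5 := hclose _ _ hx
    simp only [PiLp.sub_apply, PiLp.add_apply, hpj] at h4 ⊢
    linarith
  have hBj : ∀ x ∈ B, (x - c) j < -(R / 4) := by
    intro x hx
    have h2 := sq_apply_le_norm_sq (x - (c - p)) j
    have h4 := (abs_le.1 (abs_le_of_sq_le_sq h2 (norm_nonneg _))).2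
    have h5 := hclose _ _ hx
    simp only [PiLp.sub_apply, hpj] at h4 ⊢
    linarith
  have hAB : Disjoint A B := by
    rw [disjoint_left]
    intro x hxA hxB
    linarith [hAj x hxA, hBj x hxB]
  have hAK : A ⊆ K := by
    intro x hx
    refine hRK (mem_ball_iff_norm.2 ?_)
    have h2 := norm_add_le (x - (c + p)) p
    rw [show x - (c + p) + p = x - c by abel] at h2
    linarith [hclose _ _ hx]
  have hBK : B ⊆ K := by
    intro x hx
    refine hRK (mem_ball_iff_norm.2 ?_)
    have h2 := norm_sub_le (x - (c - p)) p
    rw [show x - (c - p) - p = x - c by abel] at h2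
    linarith [hclose _ _ hx]
  have hpM : ‖p‖ ≤ M := by
    have h2 : c + p ∈ Metric.ball c R := by
      rw [mem_ball_iff_norm, add_sub_cancel_left, hpn]
      linarith
    have h3 := mem_closedBall_iff_norm.1 (hKM (hRK h2))
    rwa [add_sub_cancel_left] at h3
  -- the two maps
  set T₀ := flattenedMap w c o (c + p) t with hT₀
  set T₁ := flattenedMap w c o (c - p) t with hT₁
  have hT₀m : Measurable T₀ := measurable_flattenedMap _ _ _ _ _
  have hT₁m : Measurable T₁ := measurable_flattenedMap _ _ _ _ _
  have hT₀A : ∀ x ∈ A, T₀ x = o + diagScale w p := by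
    intro x hx
    have h2 : T₀ x = o + diagScale w (c + p - c) := if_pos hx
    rw [h2, add_sub_cancel_left]
  have hT₀A' : ∀ x ∉ A, T₀ x = o + diagScale w (x - c) := fun x hx => if_neg hx
  have hT₁B : ∀ x ∈ B, T₁ x = o - diagScale w p := by
    intro x hx
    have h2 : T₁ x = o + diagScale w (c - p - c) := if_pos hx
    rw [h2, sub_sub_cancel_left, map_neg, sub_eq_add_neg]
  have hT₁B' : ∀ x ∉ B, T₁ x = o + diagScale w (x - c) := fun x hx => if_neg hx
  have hrange₀ : ∀ x ∈ K, T₀ x ∈ Metric.closedBall o (l * M) := fun x hx =>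
    flattenedMap_mem_closedBall hl.le hwl c o (c + p) t (by rwa [add_sub_cancel_left]) x
      (mem_closedBall_iff_norm.1 (hKM hx))
  have hrange₁ : ∀ x ∈ K, T₁ x ∈ Metric.closedBall o (l * M) := fun x hx =>
    flattenedMap_mem_closedBall hl.le hwl c o (c - p) t (by rwa [sub_sub_cancel_left, norm_neg]) x
      (mem_closedBall_iff_norm.1 (hKM hx))
  have hint : ∀ f : EuclideanSpace ℝ ι → ℝ, Continuous f → Integrable f ρ := fun f hf =>
    integrable_uniformMeasure hK0 (hf.continuousOn.integrableOn_compact hK)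
  have hρKc : ρ Kᶜ = 0 := by
    simp [hρ, uniformMeasure, hK.measurableSet.compl]
  have hsupp : ∀ T, Measurable T → (∀ x ∈ K, T x ∈ Metric.closedBall o (l * M)) →
      (ρ.map T) Yᶜ = 0 := by
    intro T hT hr
    refine measure_mono_null (compl_subset_compl.2 hY) ?_
    rw [Measure.map_apply hT Metric.isClosed_closedBall.measurableSet.compl]
    exact measure_mono_null (fun x hx hxK => hx (hr x hxK)) hρKc
  have hcost : ∀ T, Measurable T → (∀ x ∈ K, T x ∈ Metric.closedBall o (l * M)) →
      Integrable (fun x => ‖x - T x‖ ^ 2) ρ := by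
    intro T hT hr
    refine integrable_uniformMeasure hK0
      (Measure.integrableOn_of_bounded (M := (M + ‖c - o‖ + l * M) ^ 2) hKtop (by fun_prop) ?_)
    filter_upwards [ae_restrict_mem hK.measurableSet] with x hx
    have h2 := mem_closedBall_iff_norm.1 (hKM hx)
    have h3 := mem_closedBall_iff_norm'.1 (hr x hx)
    have h4 := norm_add₃_le (a := x - c) (b := c - o) (c := o - T x)
    rw [show x - c + (c - o) + (o - T x) = x - T x by abel] at h4
    rw [Real.norm_of_nonneg (by positivity)]
    exact pow_le_pow_left₀ (norm_nonneg _) (by linarith) 2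
  have hopt₀ : IsOptimalMap 2 ρ (ρ.map T₀) T₀ :=
    isOptimalMap_flattenedMap hw c o _ ht ρ hint (hcost T₀ hT₀m hrange₀)
  have hopt₁ : IsOptimalMap 2 ρ (ρ.map T₁) T₁ :=
    isOptimalMap_flattenedMap hw c o _ ht ρ hint (hcost T₁ hT₁m hrange₁)
  -- the rearrangement
  set v : EuclideanSpace ℝ ι := -(p + p) with hv
  have hshift : ∀ x, x ∈ A ↔ x + v ∈ B := by
    intro x
    rw [hA, hB, mem_ofPred_eq, mem_ofPred_eq, hv, show x + -(p + p) - (c - p) = x - (c + p) by abel]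
  set σ : EuclideanSpace ℝ ι → EuclideanSpace ℝ ι :=
    fun x => if x ∈ A then x + v else if x ∈ B then x - v else x with hσ
  have hσA : ∀ x ∈ A, σ x = x + v := fun x hx => if_pos hx
  have hσB : ∀ x ∈ B, σ x = x - v := fun x hx => by
    rw [hσ]
    simp only [if_neg (disjoint_right.1 hAB hx), if_pos hx]
  have hσo : ∀ x, x ∉ A → x ∉ B → σ x = x := fun x hxA hxB => by
    rw [hσ]
    simp only [if_neg hxA, if_neg hxB]
  have hmemA : ∀ x ∈ B, x - v ∈ A := fun x hx => by rwa [hshift, sub_add_cancel]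
  have hσK : σ ⁻¹' K = K := by
    ext x
    rw [mem_preimage]
    by_cases hxA : x ∈ A
    · rw [hσA x hxA]
      exact iff_of_true (hBK ((hshift x).1 hxA)) (hAK hxA)
    · by_cases hxB : x ∈ B
      · rw [hσB x hxB]
        exact iff_of_true (hAK (hmemA x hxB)) (hBK hxB)
      · rw [hσo x hxA hxB]
  have hσρ : MeasurePreserving σ ρ ρ := by
    have h2 := (measurePreserving_translationSwap volume A B v hAm hBm hAB hshift σ hσA hσB
      hσo).restrict_preimage hK.measurableSet
    rw [hσK] at h2
    exact h2.smul_measure _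
  have hAp : ‖diagScale w (p + p)‖ = l * h ^ 2 * R := by
    have h2 : diagScale w (p + p) = EuclideanSpace.single j (l * h ^ 2 * R) := by
      ext k
      by_cases hk : k = j
      · subst hk
        simp [diagScale_apply, hp, hwdef, hij.symm]
        ring
      · simp [diagScale_apply, hp, hk]
    rw [h2, PiLp.norm_single, Real.norm_of_nonneg (by positivity)]
  -- On `A` both images are collapsed, on `B` both follow the affine map; either way the
  -- displacement is `diagScale w (p + p)` up to sign.
  have hupper := iInf_transportCost_map_le ρ T₀ T₁ hT₀m hT₁m σ hσρ (A ∪ B) (hAm.union hBm)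
    (ENNReal.ofReal (l * h ^ 2 * R)) (by
      intro x hx
      rw [edist_dist, dist_eq_norm]
      refine ENNReal.ofReal_le_ofReal (le_of_eq ?_)
      rw [← hAp]
      rcases hx with hx | hx
      · rw [hT₀A x hx, hσA x hx, hT₁B _ ((hshift x).1 hx), map_add]
        congr 1
        abel
      · rw [hT₀A' x (disjoint_right.1 hAB hx), hσB x hx,
          hT₁B' _ (disjoint_left.1 hAB (hmemA x hx)), add_sub_add_left_eq_sub, ← map_sub,
          ← norm_neg, ← map_neg]
        congr 2
        rw [hv]
        abel) (by
      intro x hx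
      rw [mem_union, not_or] at hx
      rw [hσo x hx.1 hx.2, hT₀A' x hx.1, hT₁B' x hx.2])
  -- the lower bound
  set S : Set (EuclideanSpace ℝ ι) := {x | diagScale g (x - (c + p)) ∈ ballCap i (R / 4)} with hS
  have hSA : S ⊆ A := fun x hx => (hell _ _).2 hx.1
  have hSm : MeasurableSet S :=
    ((isOpen_ballCap i (R / 4)).preimage
      ((continuous_diagScale g).comp (continuous_sub_right (c + p)))).measurableSet
  have hSi : ∀ x ∈ S, h * (R / 8) ≤ (x - c) i := by
    intro x hx
    have h2 : R / 4 / 2 < h⁻¹ * (x - (c + p)) i := by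
      have := hx.2
      simpa only [mem_ofPred_eq, diagScale_apply, hgdef, if_true] using this
    rw [inv_mul_eq_div, lt_div_iff₀ h0] at h2
    simp only [PiLp.sub_apply, PiLp.add_apply, hpi] at h2 ⊢
    linarith
  have hlower := le_iInf_transportCost_inducedPlan ρ T₀ T₁ hT₀m hT₁m S hSm
    (ENNReal.ofReal (l / (1 + l) * (h * (R / 8)))) (by
      intro x hx x'
      rw [edist_dist]
      refine ENNReal.ofReal_le_ofReal (le_of_sq_le_sq ?_ dist_nonneg)
      rw [dist_eq_norm, WithLp.prod_norm_sq_eq_of_L2]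
      change _ ≤ ‖x - x'‖ ^ 2 + ‖T₀ x - T₁ x'‖ ^ 2
      have hll : l / (1 + l) ≤ 1 := (div_le_one (by positivity)).2 (by linarith)
      -- Over `B` the base points are far apart in direction `j`. Elsewhere `T₁` is affine, and in
      -- direction `i` the point `(x, T₀ x)` is compared with a line of slope `l`.
      by_cases hx' : x' ∈ B
      · have h2 := sq_apply_le_norm_sq (x - x') j
        have h3 := hAj x (hSA hx)
        have h4 := hBj x' hx'
        have h5 : l / (1 + l) * (h * (R / 8)) ≤ (x - x') j := by
          have : l / (1 + l) * (h * (R / 8)) ≤ 1 * (1 * (R / 8)) := by gcongr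
          simp only [PiLp.sub_apply] at h3 h4 ⊢
          linarith
        have h6 := pow_le_pow_left₀ (by positivity) h5 2
        linarith [sq_nonneg ‖T₀ x - T₁ x'‖]
      · have h2 := sq_apply_le_norm_sq (x - x') i
        have h3 := sq_apply_le_norm_sq (T₀ x - T₁ x') i
        rw [hT₀A x (hSA hx), hT₁B' x' hx', add_sub_add_left_eq_sub] at h3 ⊢
        have h4 : (diagScale w p - diagScale w (x' - c)) i = -(l * (x' - c) i) := by
          simp [diagScale_apply, hpi, hwdef]
          ring
        have h5 : (x - x') i = (x - c) i - (x' - c) i := by simp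
        rw [h4, neg_sq] at h3
        rw [h5] at h2
        refine le_trans ?_ ((sq_mul_le_sub_sq_add hl).trans (add_le_add h2 h3))
        exact pow_le_pow_left₀ (by positivity)
          (mul_le_mul_of_nonneg_left (hSi x hx) (by positivity)) 2)
  -- comparison
  have hlip := hC _ _ (Measure.isProbabilityMeasure_map hT₀m.aemeasurable)
    (Measure.isProbabilityMeasure_map hT₁m.aemeasurable) (hsupp T₀ hT₀m hrange₀)
    (hsupp T₁ hT₁m hrange₁) T₀ T₁ hopt₀ hopt₁
  have hsq : ∀ a : ℝ≥0∞, (a ^ (1 / 2 : ℝ)) ^ 2 = a := by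
    intro a
    rw [← ENNReal.rpow_natCast, ← ENNReal.rpow_mul]
    norm_num
  have hlip2 := pow_le_pow_left' hlip 2
  rw [planWassersteinDist, wassersteinDist, wassersteinDist, mul_pow, hsq, hsq] at hlip2
  have hfinal := hlower.trans (hlip2.trans (mul_le_mul_right hupper _))
  -- `S`, `A` and `B` share one scaling factor, which cancels, so its dependence on `h` is
  -- irrelevant.
  obtain ⟨κ, hκ0, hκ, hvol⟩ := exists_volume_preimage_diagScale hg
  have hρs : ∀ s ⊆ K, ρ s = (volume K)⁻¹ * volume s := by
    intro s hs
    rw [hρ, uniformMeasure, Measure.smul_apply, Measure.restrict_eq_self _ hs, smul_eq_mul]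
  have hρS : ρ S = ((volume K)⁻¹ * κ) * volume (ballCap i (R / 4)) := by
    rw [hρs S (hSA.trans hAK), hvol, mul_assoc]
  have hvA : volume A = κ * volume (Metric.ball (0 : EuclideanSpace ℝ ι) (R / 4)) := by
    simp only [hA, hell]
    exact hvol _ _
  have hvB : volume B = κ * volume (Metric.ball (0 : EuclideanSpace ℝ ι) (R / 4)) := by
    simp only [hB, hell]
    exact hvol _ _
  have hρAB : ρ (A ∪ B)
      = ((volume K)⁻¹ * κ) * (2 * volume (Metric.ball (0 : EuclideanSpace ℝ ι) (R / 4))) := by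
    rw [hρs _ (union_subset hAK hBK), measure_union hAB hBm, hvA, hvB]
    ring
  rw [hρS, hρAB, mul_left_comm, mul_left_comm (ENNReal.ofReal (l * h ^ 2 * R) ^ 2),
    mul_left_comm ((C : ℝ≥0∞) ^ 2)] at hfinal
  exact (ENNReal.mul_le_mul_iff_right (mul_ne_zero (ENNReal.inv_ne_zero.2 hKtop) hκ0)
    (ENNReal.mul_ne_top (ENNReal.inv_ne_top.2 hK0) hκ)).1 hfinal

end

/-! ### Letting the thickness tend to zero -/

theorem mainTheorem10 (d : ℕ) (hd : 2 ≤ d)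
    (K : Set (EuclideanSpace ℝ (Fin d))) (hK : IsCompact K) (hKint : (interior K).Nonempty)
    (Y : Set (EuclideanSpace ℝ (Fin d))) (hY : IsCompact Y) (hYint : (interior Y).Nonempty) :
    ¬ ∃ C : ℝ≥0, ∀ μ₀ μ₁ : Measure (EuclideanSpace ℝ (Fin d)),
      IsProbabilityMeasure μ₀ → IsProbabilityMeasure μ₁ → μ₀ Yᶜ = 0 → μ₁ Yᶜ = 0 →
      ∀ T₀ T₁ : EuclideanSpace ℝ (Fin d) → EuclideanSpace ℝ (Fin d),
        IsOptimalMap 2 (uniformMeasure K) μ₀ T₀ → IsOptimalMap 2 (uniformMeasure K) μ₁ T₁ →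
        planWassersteinDist 2 (inducedPlan (uniformMeasure K) T₀)
            (inducedPlan (uniformMeasure K) T₁)
          ≤ (C : ℝ≥0∞) * wassersteinDist 2 μ₀ μ₁ := by
  rintro ⟨C, hC⟩
  obtain ⟨c, hc⟩ := hKint
  obtain ⟨R, hR, hRK⟩ := Metric.isOpen_iff.1 isOpen_interior c hc
  obtain ⟨o, ho⟩ := hYint
  obtain ⟨r, hr, hrY⟩ := Metric.isOpen_iff.1 isOpen_interior o ho
  obtain ⟨M, hM, hKM⟩ := hK.isBounded.subset_closedBall_lt 0 c
  -- This slope sends `K` into the ball of radius `r / 2` about `o`, inside `Y`.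
  set l : ℝ := r / (2 * M) with hldef
  have hl : 0 < l := by positivity
  have hlM : l * M < r := by
    have : l * M = r / 2 := by rw [hldef]; field_simp
    linarith
  -- Here `2 ≤ d` enters: the steep direction and the direction of the centres must differ.
  have hij : (⟨0, by omega⟩ : Fin d) ≠ ⟨1, by omega⟩ := by simp
  have key := fun h : ℝ => volume_ballCap_le_of_lipschitz hij hK (hRK.trans interior_subset) hKM
    ((Metric.closedBall_subset_ball hlM).trans (hrY.trans interior_subset)) hR hl hC (h := h)
  have hu0 : 0 < volume (ballCap (⟨0, by omega⟩ : Fin d) (R / 4)) :=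
    (isOpen_ballCap _ _).measure_pos volume (ballCap_nonempty _ (by positivity))
  have hutop : volume (ballCap (⟨0, by omega⟩ : Fin d) (R / 4)) ≠ ∞ :=
    ((measure_mono inter_subset_left).trans_lt Metric.isBounded_ball.measure_lt_top).ne
  have hbtop : volume (Metric.ball (0 : EuclideanSpace ℝ (Fin d)) (R / 4)) ≠ ∞ :=
    Metric.isBounded_ball.measure_lt_top.ne
  set u := (volume (ballCap (⟨0, by omega⟩ : Fin d) (R / 4))).toReal with hu
  set b := (volume (Metric.ball (0 : EuclideanSpace ℝ (Fin d)) (R / 4))).toReal with hb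
  have hupos : 0 < u := ENNReal.toReal_pos hu0.ne' hutop
  have hbnn : 0 ≤ b := ENNReal.toReal_nonneg
  have keyR : ∀ h : ℝ, 0 < h → h ≤ 1 →
      (l / (1 + l) * (h * (R / 8))) ^ 2 * u ≤ (C : ℝ) ^ 2 * ((l * h ^ 2 * R) ^ 2 * (2 * b)) := by
    intro h h0 h1
    have h2 := ENNReal.toReal_mono (by finiteness) (key h h0 h1)
    simpa only [ENNReal.toReal_mul, ENNReal.toReal_pow, ENNReal.toReal_ofNat,
      ENNReal.coe_toReal, ENNReal.toReal_ofReal (show 0 ≤ l / (1 + l) * (h * (R / 8)) by positivity),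
      ENNReal.toReal_ofReal (show 0 ≤ l * h ^ 2 * R by positivity)] using h2
  set α := (l / (1 + l) * (R / 8)) ^ 2 * u with hα
  set β := (C : ℝ) ^ 2 * ((l * R) ^ 2 * (2 * b)) with hβ
  have hαpos : 0 < α := by positivity
  have hβnn : 0 ≤ β := by positivity
  have hsmall : ∀ h : ℝ, 0 < h → h ≤ 1 → α ≤ h * β := by
    intro h h0 h1
    have h2 := keyR h h0 h1
    have h3 : h ^ 2 * α ≤ h ^ 2 * (h ^ 2 * β) := by
      rw [hα, hβ]
      linarith
    have h4 := le_of_mul_le_mul_left h3 (by positivity)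
    have h5 : h ^ 2 * β ≤ h * β := mul_le_mul_of_nonneg_right (by nlinarith) hβnn
    exact h4.trans h5
  -- `β` may vanish, for instance when `C = 0`, hence the denominator `β + 1`.
  have h2 := hsmall (min 1 (α / (β + 1))) (lt_min one_pos (by positivity)) (min_le_left _ _)
  have h3 : min 1 (α / (β + 1)) * β ≤ α / (β + 1) * β :=
    mul_le_mul_of_nonneg_right (min_le_right _ _) hβnn
  have h4 : α / (β + 1) * β < α := by
    rw [div_mul_eq_mul_div, div_lt_iff₀ (by positivity)]
    linarith
  linarith
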